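/- Let $K$ be a field of characteristic zero, $L=K[x,y]$, and $[P,Q]=\partial_xP\,\partial_yQ-\partial_xQ\,\partial_yP$ for $P,Q\in L$. A direction is a pair $(\rho,\sigma)$ of coprime integers; $v_{\rho,\sigma}(i,j)=\rho i+\sigma j$; directions are ordered counterclockwise, so that $[(0,-1),(1,-1)[$ is the set of directions with $\rho\ge 0$ and $\rho+\sigma<0$, and $(\rho,\sigma)<(\rho',\sigma')$ in it means $\rho\sigma'-\sigma\rho'>0$. For a nonzero $(\rho,\sigma)$-homogeneous $R\in L$ let $\mathrm{st}_{\rho,\sigma}(R)$ and $\mathrm{en}_{\rho,\sigma}(R)$ be the first and the last point of the support of $R$ in the direction of the vector $(-\sigma,\rho)$. An admissible chain of length $k\in\mathbb N$ consists of points $C_0,\dots,C_k\in\mathbb N_0\times\mathbb N_0$, with $C_0=(c,0)$ for some $c>0$, of directions $(0,-1)<(\rho_1,\sigma_1)<\dots<(\rho_k,\sigma_k)<(1,-1)$, and of polynomials $R_1,\dots,R_k\in L$ such that, for $1\le j\le k$, the polynomial $R_j$ is $(\rho_j,\sigma_j)$-homogeneous, $\mathrm{st}_{\rho_j,\sigma_j}(R_j)=C_{j-1}\ne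 C_j=\mathrm{en}_{\rho_j,\sigma_j}(R_j)$, and $[R_j,G_j]=R_j^{i}$ for some $(\rho_j,\sigma_j)$-homogeneous $G_j\in L$ and some $i\in\mathbb N_0$. (It follows that $v_{1,-1}(C_j)>0$ for $0\le j\le k$ and $v_{\rho_j,\sigma_j}(C_j)\ge\rho_j$ for $1\le j\le k$.) For $(a,b)\in\mathbb N\times\mathbb N_0$ and a direction $(\rho,\sigma)\in[(0,-1),(1,-1)[$, the pair $((a,b),(\rho,\sigma))$ is a possible final pair if either $b=0$ and $(\rho,\sigma)=(0,-1)$, or there is an admissible chain of some length $k\ge 1$ with $C_k=(a,b)$ and $(\rho_k,\sigma_k)=(\rho,\sigma)$. **Proposition.** Let $((a,b),(\rho,\sigma))$ be a possible final pair with $b>0$ and $a\le 2b$. Then $v_{\rho,\sigma}(a,b)\ge\rho$, and there exists a possible final pair $((r,s),(\rho',\sigma'))$ such that 1. $r<a$, $s<b$ and $r-s<a-b$; 2. $v_{\rho,\sigma}(r,s)=v_{\rho,\sigma}(a,b)$; 3. $\overline\vartheta\le\gcd(a-r,b-s)$ or $\overline\vartheta\mid\gcd(r,s)$, where $\overline\vartheta=\dfrac{\rho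 a+\sigma b}{\gcd(\rho+\sigma,\ \rho a+\sigma b)}$. -/

import Mathlib

/-!
Lower corners of Newton polygons: directions in the plane, start and end points of the edges of a
polynomial in two variables, admissible chains and possible final pairs.
-/

namespace LowerCorner

open MvPolynomial

/-- The valuation `v_{ρ,σ}(i, j) = ρ i + σ j` of a lattice point, for `d = (ρ, σ)`. -/
def val (d : ℤ × ℤ) (p : ℕ × ℕ) : ℤ := d.1 * p.1 + d.2 * p.2

/-- A direction is a pair of coprime integers. -/
def IsDirection (d : ℤ × ℤ) : Prop := IsCoprime d.1 d.2

/-- The counterclockwise order of directions, written with the cross product. It is only used for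
directions in the arc from `(0, -1)` to `(1, -1)`, which is much shorter than a half turn. -/
def DirLT (d e : ℤ × ℤ) : Prop := 0 < d.1 * e.2 - d.2 * e.1

/-- `d` is a direction in the half-open arc `[(0,-1), (1,-1)[`. -/
def IsLowerDirection (d : ℤ × ℤ) : Prop :=
  IsDirection d ∧ (d = (0, -1) ∨ DirLT (0, -1) d) ∧ DirLT d (1, -1)

/-- The support of a polynomial in two variables, as a finite set of points of `ℕ × ℕ`:
the variable `X 0` is `x` and `X 1` is `y`. -/
def supp {K : Type*} [Field K] (P : MvPolynomial (Fin 2) K) : Finset (ℕ × ℕ) :=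
  P.support.image fun m => (m 0, m 1)

/-- The Jacobian bracket `[P, Q] = ∂ₓP ∂ᵧQ - ∂ₓQ ∂ᵧP`. -/
noncomputable def bracket {K : Type*} [Field K] (P Q : MvPolynomial (Fin 2) K) :
    MvPolynomial (Fin 2) K :=
  pderiv 0 P * pderiv 1 Q - pderiv 0 Q * pderiv 1 P

/-- `P` is `(ρ,σ)`-homogeneous: all the points `(i, j)` of its support have the same `ρ i + σ j`. -/
def IsHomogeneous {K : Type*} [Field K] (d : ℤ × ℤ) (P : MvPolynomial (Fin 2) K) : Prop :=
  ∃ n : ℤ, IsWeightedHomogeneous ![d.1, d.2] P n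

/-- `p = st_{ρ,σ}(P)`: among the points of the support of `P` that maximize `v_{ρ,σ}`, the point `p`
is the first one when the Newton polygon is traversed counterclockwise, that is, in the direction
of the vector `(-σ, ρ)`. -/
def IsStart {K : Type*} [Field K] (d : ℤ × ℤ) (P : MvPolynomial (Fin 2) K) (p : ℕ × ℕ) : Prop :=
  p ∈ supp P ∧ ∀ q ∈ supp P,
    val d q < val d p ∨ (val d q = val d p ∧ val (-d.2, d.1) p ≤ val (-d.2, d.1) q)

/-- `p = en_{ρ,σ}(P)`: among the points of the support of `P` that maximize `v_{ρ,σ}`, the point `p`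
is the last one in the direction of the vector `(-σ, ρ)`. -/
def IsEnd {K : Type*} [Field K] (d : ℤ × ℤ) (P : MvPolynomial (Fin 2) K) (p : ℕ × ℕ) : Prop :=
  p ∈ supp P ∧ ∀ q ∈ supp P,
    val d q < val d p ∨ (val d q = val d p ∧ val (-d.2, d.1) q ≤ val (-d.2, d.1) p)

/-- An admissible chain `((C_j)_{0 ≤ j ≤ k}, (R_j)_{1 ≤ j ≤ k}, (ρ_j,σ_j)_{1 ≤ j ≤ k})` of length `k`
over the field `K`; the families `R` and `dir` are indexed here by `0, …, k-1` instead of `1, …, k`.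

The inequalities `v_{1,-1}(C_j) > 0` and `v_{ρ_j,σ_j}(C_j) ≥ ρ_j` are not listed because they follow:
`C_0 = (c, 0)` with `c > 0`, each `C_j - C_{j-1}` is a positive multiple of `(-σ_j, ρ_j)`, and the
directions increase in the arc `](0,-1), (1,-1)[`. -/
structure AdmissibleChain (K : Type*) [Field K] (k : ℕ) where
  /-- the corners `C_0, …, C_k` -/
  C : Fin (k + 1) → ℕ × ℕ
  /-- the polynomials `R_1, …, R_k` -/
  R : Fin k → MvPolynomial (Fin 2) K
  /-- the directions `(ρ_1,σ_1), …, (ρ_k,σ_k)` -/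
  dir : Fin k → ℤ × ℤ
  /-- the chain starts on the positive horizontal axis -/
  first_pos : 0 < (C 0).1
  first_axis : (C 0).2 = 0
  /-- the directions lie in the open arc `](0,-1), (1,-1)[` … -/
  dir_isDirection : ∀ j : Fin k, IsDirection (dir j)
  dir_lower : ∀ j : Fin k, DirLT (0, -1) (dir j)
  dir_upper : ∀ j : Fin k, DirLT (dir j) (1, -1)
  /-- … and increase -/
  dir_strictMono : ∀ i j : Fin k, i < j → DirLT (dir i) (dir j)
  /-- `R_j` is `(ρ_j,σ_j)`-homogeneous, with start point `C_{j-1}` and end point `C_j` -/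
  homogeneous : ∀ j : Fin k, IsHomogeneous (dir j) (R j)
  start_eq : ∀ j : Fin k, IsStart (dir j) (R j) (C j.castSucc)
  end_eq : ∀ j : Fin k, IsEnd (dir j) (R j) (C j.succ)
  /-- `R_j` is not a monomial -/
  corner_ne : ∀ j : Fin k, C j.castSucc ≠ C j.succ
  /-- there is a `(ρ_j,σ_j)`-homogeneous polynomial `G` with `[R_j, G] = R_j ^ i` for some `i` -/
  exists_bracket_eq : ∀ j : Fin k, ∃ G : MvPolynomial (Fin 2) K, IsHomogeneous (dir j) G ∧
    ∃ i : ℕ, bracket (R j) G = R j ^ i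

/-- `((a,b),(ρ,σ))` is a possible final pair, for `p = (a, b)` in `ℕ × ℕ` with `a > 0` and a direction
`d = (ρ, σ)` in `[(0,-1), (1,-1)[`: either `b = 0` and `(ρ,σ) = (0,-1)`, or there is an admissible
chain of positive length `k = n + 1` that ends with `C_k = (a,b)` and `(ρ_k,σ_k) = (ρ,σ)`. -/
def IsPossibleFinalPair (K : Type*) [Field K] (p : ℕ × ℕ) (d : ℤ × ℤ) : Prop :=
  0 < p.1 ∧ IsLowerDirection d ∧
    ((p.2 = 0 ∧ d = (0, -1)) ∨
      ∃ (n : ℕ) (c : AdmissibleChain K (n + 1)), c.C (Fin.last (n + 1)) = p ∧ c.dir (Fin.last n) = d)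

/-- `ϑ̄ = (ρ a + σ b) / gcd(ρ + σ, ρ a + σ b)`; the division of integers is exact. -/
def thetaBar (p : ℕ × ℕ) (d : ℤ × ℤ) : ℤ :=
  val d p / (Int.gcd (d.1 + d.2) (val d p) : ℤ)

end LowerCorner

/-! The new pair comes from the penultimate corner `(r, s)` of the chain. The last edge is `m` times
the primitive vector `(-σ, ρ)`, with `-σ > ρ > 0`; this gives (1) and (2), and `m = gcd(a - r, b -
s)`.

For (3), put `y = 1`, `P = R(x, 1)`, `Q = G(x, 1)`. Let `n > 0` be the weight of `R` and `δ = -(ρ +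
σ) > 0`. Euler's identity turns the bracket equation into `w P' Q - n P Q' = σ P ^ (N + 1)` with `w
= N n - δ` (`ode_of_bracket_eq`, `weight_of_bracket_eq`). At a root of `P` of order `μ`, `Q` has the
generic order `N μ + 1` or a resonant order `ν` with `n ν = w μ` (`rootMultiplicity_of_ode`). Both
`0` and some `β ≠ 0` are roots of `P`, so generic orders everywhere would give `deg Q ≥ N deg P +
2`, against `natDegree_le_of_ode`. Hence some root is resonant, and there `n ∣ δ μ`, that is, `ϑ̄ ∣
μ`. At a nonzero root `μ ≤ m`, because `P` has at most `m + 1` terms; at `0` one has `μ = r`, and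
homogeneity gives the same divisibility for `s`. -/

namespace LowerCorner

/-! ### Orders of vanishing for the univariate differential equation -/

section Univariate

open Polynomial

variable {F : Type*} [Field F]

lemma exponent_eq_of_pow_mul_eq {α : F} {A B : ℕ} {U V : F[X]} (hU : U.eval α ≠ 0)
    (hV : V.eval α ≠ 0) (h : (X - C α) ^ A * U = (X - C α) ^ B * V) : A = B := by
  have key : ∀ (n : ℕ) (W : F[X]), W.eval α ≠ 0 →
      ((X - C α) ^ n * W).rootMultiplicity α = n := by
    intro n W hW
    rw [mul_comm, rootMultiplicity_mul_X_sub_C_pow (by rintro rfl; simp at hW),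
      rootMultiplicity_eq_zero hW, zero_add]
  rw [← key A U hU, h, key B V hV]

lemma exists_eq_pow_rootMultiplicity_mul {P : F[X]} (hP : P ≠ 0) (α : F) :
    ∃ U : F[X], P = (X - C α) ^ P.rootMultiplicity α * U ∧ U.eval α ≠ 0 := by
  obtain ⟨U, hU, hd⟩ := exists_eq_pow_rootMultiplicity_mul_and_not_dvd P hP α
  exact ⟨U, hU, fun h => hd (dvd_iff_isRoot.2 h)⟩

/-- The operator `(X - α) d/dX` preserves the power of `X - α`, so the exponent `k - 1` never
appears and `k = 0` is not special. -/
lemma X_sub_C_mul_derivative_pow_mul (α : F) (k : ℕ) (U : F[X]) :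
    (X - C α) * derivative ((X - C α) ^ k * U) =
      (X - C α) ^ k * ((k : F[X]) * U + (X - C α) * derivative U) := by
  rcases k with _ | k
  · simp
  · simp only [derivative_mul, derivative_X_sub_C_pow, Nat.add_sub_cancel, C_eq_natCast]
    ring

variable [CharZero F]

/-- A solution of `w P' Q - n P Q' = σ P ^ (N + 1)` vanishes at a root of `P` either to the order
`N μ + 1`, or to an order for which the leading term of the left hand side cancels. -/
lemma rootMultiplicity_of_ode {P Q : F[X]} {n w σ : ℤ} {N : ℕ} (hP : P ≠ 0) (hQ : Q ≠ 0)
    (hσ : σ ≠ 0)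
    (h : (w : F[X]) * derivative P * Q - (n : F[X]) * P * derivative Q =
      (σ : F[X]) * P ^ (N + 1)) (α : F) :
    Q.rootMultiplicity α = N * P.rootMultiplicity α + 1 ∨
      n * Q.rootMultiplicity α = w * P.rootMultiplicity α := by
  obtain ⟨U, hU, hU0⟩ := exists_eq_pow_rootMultiplicity_mul hP α
  obtain ⟨V, hV, hV0⟩ := exists_eq_pow_rootMultiplicity_mul hQ α
  set μ := P.rootMultiplicity α
  set ν := Q.rootMultiplicity α
  by_cases hc : n * (ν : ℤ) = w * μ
  · exact Or.inr hc
  left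
  have e1 := X_sub_C_mul_derivative_pow_mul α μ U
  have e2 := X_sub_C_mul_derivative_pow_mul α ν V
  rw [← hU] at e1
  rw [← hV] at e2
  -- At `α` the left cofactor is `(w μ - n ν) U(α) V(α)`, nonzero off resonance; comparing exponents
  -- then gives `μ + ν = μ (N + 1) + 1`.
  have e3 : (X - C α) ^ (μ + ν) *
      ((w : F[X]) * ((μ : F[X]) * U + (X - C α) * derivative U) * V -
        (n : F[X]) * U * ((ν : F[X]) * V + (X - C α) * derivative V)) =
      (X - C α) ^ (μ * (N + 1) + 1) * ((σ : F[X]) * U ^ (N + 1)) := by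
    have e4 : (X - C α) * ((w : F[X]) * derivative P * Q - (n : F[X]) * P * derivative Q) =
        (X - C α) * ((σ : F[X]) * P ^ (N + 1)) := by rw [h]
    have e5 : (X - C α) * ((σ : F[X]) * P ^ (N + 1)) =
        (X - C α) ^ (μ * (N + 1) + 1) * ((σ : F[X]) * U ^ (N + 1)) := by
      rw [hU, mul_pow, ← pow_mul]; ring
    rw [← e5, ← e4]
    have e6 : (X - C α) * ((w : F[X]) * derivative P * Q - (n : F[X]) * P * derivative Q) =
        (w : F[X]) * ((X - C α) * derivative P) * Q -
          (n : F[X]) * P * ((X - C α) * derivative Q) := by ring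
    rw [e6, e1, e2]
    linear_combination
      (-((w : F[X]) * ((X - C α) ^ μ * ((μ : F[X]) * U + (X - C α) * derivative U)))) * hV +
      ((n : F[X]) * ((X - C α) ^ ν * ((ν : F[X]) * V + (X - C α) * derivative V))) * hU
  have e7 := exponent_eq_of_pow_mul_eq (α := α) ?_ ?_ e3
  · nlinarith
  · have : (w : F) * (μ * U.eval α) * V.eval α - n * U.eval α * (ν * V.eval α) =
        ((w * μ - n * ν : ℤ) : F) * (U.eval α * V.eval α) := by push_cast; ring
    simp only [eval_sub, eval_mul, eval_add, eval_intCast, eval_natCast, eval_X, eval_C, sub_self,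
      zero_mul, add_zero]
    rw [this]
    refine mul_ne_zero (Int.cast_ne_zero.2 fun h0 => hc ?_) (mul_ne_zero hU0 hV0)
    linarith
  · simp [hσ, hU0]

/-- If `deg Q > N deg P + 1`, the right-hand side has too small a degree to cancel the top
coefficient on the left, which is a nonzero multiple of `(N n - δ) deg P - n deg Q < 0`. -/
lemma natDegree_le_of_ode {P Q : F[X]} {n δ σ : ℤ} {N : ℕ} (hP : P ≠ 0) (hn : 0 < n) (hδ : 0 < δ)
    (h : ((N * n - δ : ℤ) : F[X]) * derivative P * Q - (n : F[X]) * P * derivative Q =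
      (σ : F[X]) * P ^ (N + 1)) :
    Q.natDegree ≤ N * P.natDegree + 1 := by
  by_contra! hlt
  set a := P.natDegree with ha
  set D := Q.natDegree with hD
  have hQ : Q ≠ 0 := by rintro rfl; simp at hD; omega
  have h2 : X * (((N * n - δ : ℤ) : F[X]) * derivative P * Q - (n : F[X]) * P * derivative Q) =
      X * ((σ : F[X]) * P ^ (N + 1)) := by rw [h]
  have h1 := congrArg (fun p : F[X] => p.coeff (a + D)) h2
  have hr : (X * ((σ : F[X]) * P ^ (N + 1))).coeff (a + D) = 0 := by
    apply coeff_eq_zero_of_natDegree_lt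
    have h3 : (X * ((σ : F[X]) * P ^ (N + 1))).natDegree ≤ 1 + (0 + (N + 1) * a) := by
      refine natDegree_mul_le_of_le natDegree_X_le (natDegree_mul_le_of_le ?_ ?_)
      · simp
      · exact natDegree_pow_le_of_le _ le_rfl
    have : (N + 1) * a = N * a + a := by ring
    omega
  have hder : ∀ p : F[X], (X * derivative p).coeff p.natDegree = p.natDegree * p.leadingCoeff := by
    intro p
    rcases hp : p.natDegree with _ | k
    · simp
    · rw [coeff_X_mul, coeff_derivative, ← hp, leadingCoeff, hp]
      push_cast; ring
  have hdeg : ∀ p : F[X], (X * derivative p).natDegree ≤ p.natDegree := by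
    intro p
    rw [natDegree_le_iff_coeff_eq_zero]
    intro k hk
    rcases k with _ | k
    · simp
    · rw [coeff_X_mul, coeff_derivative, coeff_eq_zero_of_natDegree_lt hk, zero_mul]
  have hl : X * (((N * n - δ : ℤ) : F[X]) * derivative P * Q - (n : F[X]) * P * derivative Q) =
      C ((N * n - δ : ℤ) : F) * ((X * derivative P) * Q) -
        C (n : F) * (P * (X * derivative Q)) := by
    simp only [← C_eq_intCast]; push_cast; ring
  simp only [hr, hl, coeff_sub, coeff_C_mul] at h1
  rw [coeff_mul_add_eq_of_natDegree_le (hdeg P) le_rfl,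
    coeff_mul_add_eq_of_natDegree_le le_rfl (hdeg Q), hder, hder, coeff_natDegree,
    coeff_natDegree] at h1
  have h4 : ((N * n - δ : ℤ) : F) * (P.natDegree * P.leadingCoeff * Q.leadingCoeff) -
      (n : F) * (P.leadingCoeff * (Q.natDegree * Q.leadingCoeff)) =
      (((N * n - δ) * a - n * D : ℤ) : F) * (P.leadingCoeff * Q.leadingCoeff) := by
    push_cast; ring
  rw [h4] at h1
  have h5 : ((N * n - δ) * a - n * D : ℤ) ≠ 0 := by
    have : (N * a + 1 : ℤ) < D := by exact_mod_cast hlt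
    have ha0 : (0 : ℤ) ≤ a := by positivity
    nlinarith [mul_nonneg hδ.le ha0]
  exact (mul_ne_zero (Int.cast_ne_zero.2 h5)
    (mul_ne_zero (leadingCoeff_ne_zero.2 hP) (leadingCoeff_ne_zero.2 hQ))) h1

/-- In characteristic zero, a polynomial with `k` terms has only nonzero roots of multiplicity
less than `k`. -/
lemma rootMultiplicity_lt_card_support {α : F} (hα : α ≠ 0) :
    ∀ (k : ℕ) (P : F[X]), P ≠ 0 → P.support.card = k → P.rootMultiplicity α < k := by
  intro k
  induction k with
  | zero => intro P hP h; simp at h; exact absurd h hP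
  | succ k ih =>
    intro P hP h
    -- Removing the power of `X` makes the constant term nonzero, so differentiation loses exactly
    -- one term and lowers the multiplicity at a root by one.
    obtain ⟨U, hU, hU0⟩ := exists_eq_pow_rootMultiplicity_mul hP 0
    have hU0' : U.coeff 0 ≠ 0 := by rwa [coeff_zero_eq_eval_zero]
    have hUne : U ≠ 0 := by rintro rfl; simp at hU0
    rw [C_0, sub_zero] at hU
    set e := P.rootMultiplicity 0
    have hmult : P.rootMultiplicity α = U.rootMultiplicity α := by
      rw [hU, rootMultiplicity_mul (hU ▸ hP), rootMultiplicity_eq_zero (by simp [hα]), zero_add]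
    have hcard : U.support.card = k + 1 := by
      rw [← h, hU]
      refine (Finset.card_bij (fun i _ => i + e) ?_ ?_ ?_)
      · intro i hi; simpa [coeff_X_pow_mul] using hi
      · intro i _ j _ hij; simpa using hij
      · intro j hj
        rw [mem_support_iff, coeff_X_pow_mul'] at hj
        split_ifs at hj with hle
        · exact ⟨j - e, by simpa using hj, by omega⟩
        · simp at hj
    rw [hmult]
    by_cases hr : U.IsRoot α
    · have hpos := (rootMultiplicity_pos hUne).2 hr
      have hd : derivative U ≠ 0 := by
        intro hd
        rw [eq_C_of_derivative_eq_zero hd] at hr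
        simp at hr
        exact hU0' hr
      have hsupp : (derivative U).support.card = k := by
        have : (derivative U).support.card = (U.support.erase 0).card := by
          refine (Finset.card_bij (fun i _ => i + 1) ?_ ?_ ?_)
          · intro i hi
            rw [mem_support_iff, coeff_derivative] at hi
            simpa using left_ne_zero_of_mul hi
          · intro i _ j _ hij; simpa using hij
          · intro j hj
            rw [Finset.mem_erase, mem_support_iff] at hj
            obtain ⟨i, rfl⟩ := Nat.exists_eq_succ_of_ne_zero hj.1
            refine ⟨i, ?_, rfl⟩
            rw [mem_support_iff, coeff_derivative]
            exact mul_ne_zero hj.2 (by exact_mod_cast Nat.succ_ne_zero i)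
        rw [this, Finset.card_erase_of_mem (by simpa using hU0'), hcard, Nat.add_sub_cancel]
      have := ih _ hd hsupp
      rw [derivative_rootMultiplicity_of_root hr] at this
      omega
    · rw [rootMultiplicity_eq_zero hr]; omega

/-- If the order of `Q` at every nonzero root of `P` is the generic one, then the order at `0` is
not, unless `P` is a monomial. -/
lemma exists_resonant_root_of_ode {P Q : F[X]} {n δ σ : ℤ} {N : ℕ} [IsAlgClosed F]
    (hP : P ≠ 0) (hσ : σ ≠ 0) (hn : 0 < n) (hδ : 0 < δ)
    (h : ((N * n - δ : ℤ) : F[X]) * derivative P * Q - (n : F[X]) * P * derivative Q =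
      (σ : F[X]) * P ^ (N + 1)) (h0 : P.IsRoot 0) {β : F} (hβ : β ≠ 0) (hβP : P.IsRoot β) :
    (∃ α : F, α ≠ 0 ∧ P.IsRoot α ∧ n ∣ δ * P.rootMultiplicity α) ∨
      n * Q.rootMultiplicity 0 = (N * n - δ) * P.rootMultiplicity 0 := by
  classical
  have hQ : Q ≠ 0 := by
    rintro rfl
    have : (σ : F[X]) * P ^ (N + 1) ≠ 0 :=
      mul_ne_zero (Int.cast_ne_zero.2 hσ) (pow_ne_zero _ hP)
    apply this
    rw [← h]; simp
  by_contra! hcon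
  obtain ⟨hc1, hc2⟩ := hcon
  have hgen : ∀ α, P.IsRoot α → Q.rootMultiplicity α = N * P.rootMultiplicity α + 1 := by
    intro α hα
    refine (rootMultiplicity_of_ode hP hQ hσ h α).resolve_right fun hr => ?_
    by_cases hα0 : α = 0
    · exact hc2 (hα0 ▸ hr)
    · exact hc1 α hα0 hα ⟨N * P.rootMultiplicity α - Q.rootMultiplicity α, by linear_combination hr⟩
  -- Each root of `P` contributes one more than `N μ`; keeping this excess only at `0` and `β`
  -- already exceeds the degree bound by one.
  have hle : N • P.roots + {0, β} ≤ Q.roots := by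
    rw [Multiset.le_iff_count]
    intro α
    simp only [Multiset.count_add, Multiset.count_nsmul, count_roots, Multiset.insert_eq_cons,
      Multiset.count_cons, Multiset.count_singleton]
    by_cases hα : P.IsRoot α
    · rw [hgen α hα]
      split_ifs with h1 h2 <;> first | omega | exact absurd (h1.symm.trans h2) hβ
    · have h1 : α ≠ 0 := by rintro rfl; exact hα h0
      have h2 : α ≠ β := by rintro rfl; exact hα hβP
      simp [rootMultiplicity_eq_zero hα, h1, h2]
  have hcard := Multiset.card_le_card hle
  have hsplit : P.roots.card = P.natDegree := (IsAlgClosed.splits P).natDegree_eq_card_roots.symm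
  simp only [Multiset.card_add, Multiset.card_nsmul, hsplit, Multiset.card_pair] at hcard
  have := natDegree_le_of_ode hP hn hδ h
  have := Q.card_roots'
  omega

end Univariate

/-! ### From the bracket equation to the differential equation -/

section Dehomogenization

open MvPolynomial

variable {K : Type*} [Field K]

/-- The substitution `y = 1`. -/
noncomputable def dehomogenize : MvPolynomial (Fin 2) K →ₐ[K] Polynomial K :=
  aeval ![Polynomial.X, 1]

lemma dehomogenize_monomial (m : Fin 2 →₀ ℕ) (c : K) :
    dehomogenize (monomial m c) = Polynomial.monomial (m 0) c := by
  rw [dehomogenize, aeval_monomial, Finsupp.prod_fintype _ _ (by simp), Fin.prod_univ_two]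
  simp [← Polynomial.C_mul_X_pow_eq_monomial]

lemma dehomogenize_pderiv_zero (R : MvPolynomial (Fin 2) K) :
    dehomogenize (pderiv 0 R) = Polynomial.derivative (dehomogenize R) := by
  induction R using MvPolynomial.induction_on' with
  | monomial m c =>
    simp [pderiv_monomial, dehomogenize_monomial, Polynomial.derivative_monomial]
  | add p q hp hq => simp [hp, hq]

lemma weight_eq_val (d : ℤ × ℤ) (m : Fin 2 →₀ ℕ) :
    Finsupp.weight ![d.1, d.2] m = val d (m 0, m 1) := by
  rw [Finsupp.weight_apply, Finsupp.sum_fintype _ _ (by simp), Fin.sum_univ_two]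
  simp [val, mul_comm]

lemma mem_supp_iff {R : MvPolynomial (Fin 2) K} {p : ℕ × ℕ} :
    p ∈ supp R ↔ ∃ m : Fin 2 →₀ ℕ, R.coeff m ≠ 0 ∧ m 0 = p.1 ∧ m 1 = p.2 := by
  simp [supp, Prod.ext_iff]

lemma val_eq_of_mem_supp {d : ℤ × ℤ} {R : MvPolynomial (Fin 2) K} {n : ℤ}
    (hR : IsWeightedHomogeneous ![d.1, d.2] R n) {p : ℕ × ℕ} (hp : p ∈ supp R) : val d p = n := by
  obtain ⟨m, hm, h0, h1⟩ := mem_supp_iff.1 hp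
  rw [← hR hm, weight_eq_val, h0, h1]

/-- Euler's identity after the substitution `y = 1`. -/
lemma dehomogenize_pderiv_one {d : ℤ × ℤ} {R : MvPolynomial (Fin 2) K} {n : ℤ}
    (hR : IsWeightedHomogeneous ![d.1, d.2] R n) :
    (d.2 : Polynomial K) * dehomogenize (pderiv 1 R) = (n : Polynomial K) * dehomogenize R -
      (d.1 : Polynomial K) * (Polynomial.X * Polynomial.derivative (dehomogenize R)) := by
  rw [R.as_sum]
  simp only [map_sum, Finset.mul_sum, ← Finset.sum_sub_distrib]
  refine Finset.sum_congr rfl fun m hm => ?_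
  have hn := hR (mem_support_iff.1 hm)
  rw [weight_eq_val] at hn
  simp only [pderiv_monomial, dehomogenize_monomial, Polynomial.derivative_monomial]
  have h0 : (m - Finsupp.single 1 1 : Fin 2 →₀ ℕ) 0 = m 0 := by simp
  have hX : Polynomial.X * Polynomial.monomial (m 0 - 1) (coeff m R * (m 0 : K)) =
      Polynomial.monomial (m 0) (coeff m R * (m 0 : K)) := by
    rcases m 0 with _ | k
    · simp
    · simp [Polynomial.X_mul_monomial]
  rw [h0, hX, ← hn]
  simp only [← Polynomial.C_eq_intCast, Polynomial.C_mul_monomial, val]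
  rw [← Polynomial.monomial_sub]
  congr 1
  push_cast
  ring

/-- As `σ ≠ 0`, a point on a line of constant valuation is determined by its abscissa, so no terms
merge when `y = 1`. -/
lemma coeff_dehomogenize {d : ℤ × ℤ} (hd : d.2 ≠ 0) {R : MvPolynomial (Fin 2) K} {n : ℤ}
    (hR : IsWeightedHomogeneous ![d.1, d.2] R n) {p : ℕ × ℕ} (hp : p ∈ supp R) :
    (dehomogenize R).coeff p.1 ≠ 0 := by
  obtain ⟨m, hm, h0, h1⟩ := mem_supp_iff.1 hp
  have : (dehomogenize R).coeff p.1 = coeff m R := by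
    conv_lhs => rw [R.as_sum]
    rw [map_sum, Polynomial.finsetSum_coeff, Finset.sum_eq_single m]
    · rw [dehomogenize_monomial, h0, Polynomial.coeff_monomial, if_pos rfl]
    · intro m' hm' hne
      rw [dehomogenize_monomial, Polynomial.coeff_monomial, if_neg]
      intro h0'
      apply hne
      have e1 := hR (mem_support_iff.1 hm')
      have e2 := hR hm
      rw [weight_eq_val] at e1 e2
      simp only [val, h0', h0] at e1 e2
      have e3 : d.2 * (m' 1 : ℤ) = d.2 * (m 1 : ℤ) := by linarith
      have e4 : m' 1 = m 1 := by exact_mod_cast mul_left_cancel₀ hd e3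
      ext i
      fin_cases i
      · simp [h0, h0']
      · simpa using e4
    · intro hm'; exact absurd (mem_support_iff.2 hm) hm'
  rwa [this]

lemma exists_mem_supp_of_coeff_dehomogenize_ne_zero {R : MvPolynomial (Fin 2) K} {i : ℕ}
    (h : (dehomogenize R).coeff i ≠ 0) : ∃ j, (i, j) ∈ supp R := by
  rw [R.as_sum, map_sum, Polynomial.finsetSum_coeff] at h
  obtain ⟨m, hm, hne⟩ := Finset.exists_ne_zero_of_sum_ne_zero h
  rw [dehomogenize_monomial, Polynomial.coeff_monomial] at hne
  split_ifs at hne with h0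
  · exact ⟨m 1, mem_supp_iff.2 ⟨m, hne, h0, rfl⟩⟩
  · exact absurd rfl hne

/-- The degree of a homogeneous solution `G` of `[R, G] = R ^ i`. -/
lemma weight_of_bracket_eq {d : ℤ × ℤ} {R G : MvPolynomial (Fin 2) K} {n w : ℤ} {i : ℕ}
    (hR : IsWeightedHomogeneous ![d.1, d.2] R n) (hG : IsWeightedHomogeneous ![d.1, d.2] G w)
    (hR0 : R ≠ 0) (h : bracket R G = R ^ i) : w = (i - 1) * n + (d.1 + d.2) := by
  have hx : ∀ {S : MvPolynomial (Fin 2) K} {k : ℤ}, IsWeightedHomogeneous ![d.1, d.2] S k →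
      IsWeightedHomogeneous ![d.1, d.2] (pderiv 0 S) (k - d.1) := fun hS =>
    hS.pderiv (by simp)
  have hy : ∀ {S : MvPolynomial (Fin 2) K} {k : ℤ}, IsWeightedHomogeneous ![d.1, d.2] S k →
      IsWeightedHomogeneous ![d.1, d.2] (pderiv 1 S) (k - d.2) := fun hS =>
    hS.pderiv (by simp)
  have h1 := (hx hR).mul (hy hG)
  have h2 := (hx hG).mul (hy hR)
  have e1 : n - d.1 + (w - d.2) = n + w - (d.1 + d.2) := by ring
  have e2 : w - d.1 + (n - d.2) = n + w - (d.1 + d.2) := by ring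
  rw [e1] at h1
  rw [e2] at h2
  have h3 : IsWeightedHomogeneous ![d.1, d.2] (bracket R G) (n + w - (d.1 + d.2)) :=
    (weightedHomogeneousSubmodule K _ _).sub_mem h1 h2
  rw [h] at h3
  have h4 := IsWeightedHomogeneous.inj_right (pow_ne_zero i hR0) h3 (hR.pow i)
  simp only [nsmul_eq_mul] at h4
  linarith

/-- After multiplication by `σ`, Euler's identity eliminates both `y`-derivatives, and the two terms
`ρ X P' Q'` cancel. -/
lemma ode_of_bracket_eq {d : ℤ × ℤ} {R G : MvPolynomial (Fin 2) K} {n w : ℤ} {i : ℕ}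
    (hR : IsWeightedHomogeneous ![d.1, d.2] R n) (hG : IsWeightedHomogeneous ![d.1, d.2] G w)
    (h : bracket R G = R ^ i) :
    (w : Polynomial K) * Polynomial.derivative (dehomogenize R) * dehomogenize G -
      (n : Polynomial K) * dehomogenize R * Polynomial.derivative (dehomogenize G) =
      (d.2 : Polynomial K) * dehomogenize R ^ i := by
  have h1 := congrArg dehomogenize h
  rw [bracket, map_sub, map_mul, map_mul, dehomogenize_pderiv_zero, dehomogenize_pderiv_zero,
    map_pow] at h1
  rw [← h1]
  linear_combination (-Polynomial.derivative (dehomogenize R)) * dehomogenize_pderiv_one hG +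
    Polynomial.derivative (dehomogenize G) * dehomogenize_pderiv_one hR

/-- Replacing `G` by `R * G` raises the exponent by one, so it may be assumed positive. -/
lemma bracket_mul_self (R G : MvPolynomial (Fin 2) K) : bracket R (R * G) = R * bracket R G := by
  simp only [bracket, Derivation.leibniz, smul_eq_mul]
  ring

end Dehomogenization

/-! ### Divisibility and lattice lines -/

section Arithmetic

lemma ediv_gcd_dvd_of_dvd_mul {s n μ : ℤ} (hn : n ≠ 0) (h : n ∣ s * μ) :
    n / (Int.gcd s n : ℤ) ∣ μ := by
  have hg : (Int.gcd s n : ℤ) ≠ 0 := by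
    simpa [Int.gcd_eq_zero_iff] using fun _ => hn
  have h2 : n ∣ (Int.gcd s n : ℤ) * μ := by
    rw [Int.gcd_comm]; exact Int.dvd_gcd_mul_iff_dvd_mul.2 h
  obtain ⟨n', hn'⟩ := Int.gcd_dvd_right s n
  nth_rewrite 1 [hn'] at h2 ⊢
  rw [Int.mul_ediv_cancel_left _ hg]
  exact (mul_dvd_mul_iff_left hg).1 h2

lemma exists_eq_add_of_val_eq {d : ℤ × ℤ} (hd : IsDirection d) {p q : ℕ × ℕ}
    (h : val d p = val d q) :
    ∃ k : ℤ, (q.1 : ℤ) = p.1 + -d.2 * k ∧ (q.2 : ℤ) = p.2 + d.1 * k := by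
  obtain ⟨u, v, huv⟩ := hd
  simp only [val] at h
  -- The Bézout relation `u ρ + v σ = 1` recovers `k` from the displacement `k (-σ, ρ)`.
  refine ⟨u * (q.2 - p.2) - v * (q.1 - p.1), ?_, ?_⟩
  · linear_combination (-(q.1 - p.1 : ℤ)) * huv + (-u) * h
  · linear_combination (-(q.2 - p.2 : ℤ)) * huv + (-v) * h

end Arithmetic

/-! ### The edge between two consecutive corners -/

section Edge

open MvPolynomial

variable {K : Type*} [Field K]

lemma rootMultiplicity_zero_eq {P : Polynomial K} {r : ℕ} (hr : P.coeff r ≠ 0)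
    (h : ∀ i, P.coeff i ≠ 0 → r ≤ i) : P.rootMultiplicity 0 = r := by
  rw [Polynomial.rootMultiplicity_eq_natTrailingDegree']
  have hP : P ≠ 0 := by rintro rfl; simp at hr
  refine le_antisymm (Polynomial.natTrailingDegree_le_of_ne_zero hr) (h _ ?_)
  exact (Polynomial.trailingCoeff_nonzero_iff_nonzero (p := P)).2 hP

lemma exists_ne_zero_isRoot [IsAlgClosed K] {P : Polynomial K} {a : ℕ}
    (ha : P.coeff a ≠ 0) (hr : P.rootMultiplicity 0 < a) : ∃ β : K, β ≠ 0 ∧ P.IsRoot β := by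
  have hP : P ≠ 0 := by rintro rfl; simp at ha
  obtain ⟨U, hU, hU0⟩ := exists_eq_pow_rootMultiplicity_mul hP 0
  have hdeg : U.degree ≠ 0 := by
    intro hdeg
    rw [Polynomial.eq_C_of_degree_eq_zero hdeg, Polynomial.C_0, sub_zero] at hU
    rw [hU, Polynomial.coeff_X_pow_mul', if_pos hr.le, Polynomial.coeff_C,
      if_neg (by omega)] at ha
    exact ha rfl
  obtain ⟨β, hβ⟩ := IsAlgClosed.exists_root U hdeg
  refine ⟨β, ?_, ?_⟩
  · rintro rfl; exact hU0 hβ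
  · rw [hU, Polynomial.IsRoot, Polynomial.eval_mul, hβ.eq_zero, mul_zero]

/-- The points of the support of a homogeneous polynomial lie on the lattice segment from its
start point to its end point. -/
lemma exists_edge_coordinates {d : ℤ × ℤ} (hd : IsDirection d) (hρ : 0 < d.1)
    {R : MvPolynomial (Fin 2) K} {n : ℤ} (hR : IsWeightedHomogeneous ![d.1, d.2] R n)
    {p q : ℕ × ℕ} (hp : IsStart d R p) (hq : IsEnd d R q) (hpq : p ≠ q) :
    ∃ m : ℕ, 0 < m ∧ (q.1 : ℤ) = p.1 + -d.2 * m ∧ (q.2 : ℤ) = p.2 + d.1 * m ∧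
      ∀ z ∈ supp R, ∃ k : ℕ, k ≤ m ∧ (z.1 : ℤ) = p.1 + -d.2 * k ∧ (z.2 : ℤ) = p.2 + d.1 * k := by
  have hv : ∀ z ∈ supp R, val d z = n := fun z hz => val_eq_of_mem_supp hR hz
  -- A shift by `k (-σ, ρ)` changes `v_{-σ,ρ}` by `k (ρ² + σ²)`, so the order along the edge is the
  -- order of `k`.
  have hpos : 0 < d.2 * d.2 + d.1 * d.1 := by nlinarith [mul_self_nonneg d.2, mul_pos hρ hρ]
  have key : ∀ z ∈ supp R, ∃ k : ℕ, (z.1 : ℤ) = p.1 + -d.2 * k ∧ (z.2 : ℤ) = p.2 + d.1 * k := by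
    intro z hz
    obtain ⟨k, h1, h2⟩ := exists_eq_add_of_val_eq hd ((hv p hp.1).trans (hv z hz).symm)
    have h3 : val (-d.2, d.1) p ≤ val (-d.2, d.1) z := by
      rcases hp.2 z hz with h | h
      · rw [hv p hp.1, hv z hz] at h; exact absurd h (lt_irrefl _)
      · exact h.2
    simp only [val, h1, h2] at h3
    have h4 : 0 ≤ (d.2 * d.2 + d.1 * d.1) * k := by linarith
    lift k to ℕ using nonneg_of_mul_nonneg_right h4 hpos
    exact ⟨k, h1, h2⟩
  obtain ⟨m, h1, h2⟩ := key q hq.1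
  refine ⟨m, ?_, h1, h2, fun z hz => ?_⟩
  · rcases Nat.eq_zero_or_pos m with rfl | h
    · exfalso; apply hpq; ext
      · simpa using h1.symm
      · simpa using h2.symm
    · exact h
  · obtain ⟨k, h3, h4⟩ := key z hz
    refine ⟨k, ?_, h3, h4⟩
    have h5 : val (-d.2, d.1) z ≤ val (-d.2, d.1) q := by
      rcases hq.2 z hz with h | h
      · rw [hv q hq.1, hv z hz] at h; exact absurd h (lt_irrefl _)
      · exact h.2
    simp only [val, h1, h2, h3, h4] at h5
    have h6 : 0 ≤ (d.2 * d.2 + d.1 * d.1) * ((m : ℤ) - k) := by linarith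
    have := nonneg_of_mul_nonneg_right h6 hpos
    omega

variable [CharZero K]

/-- The start point of an edge that satisfies the bracket condition. -/
theorem thetaBar_le_or_dvd_of_edge {d : ℤ × ℤ} (hd : IsDirection d) (hρ : 0 < d.1)
    (hρσ : d.1 + d.2 < 0) {R : MvPolynomial (Fin 2) K} (hR : IsHomogeneous d R) {p q : ℕ × ℕ}
    (hp : IsStart d R p) (hq : IsEnd d R q) (hpq : p ≠ q) (hp1 : 0 < p.1) (hval : 0 < val d p)
    (hG : ∃ G : MvPolynomial (Fin 2) K, IsHomogeneous d G ∧ ∃ i : ℕ, bracket R G = R ^ i) :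
    (p.1 < q.1 ∧ p.2 < q.2 ∧ (p.1 : ℤ) - p.2 < q.1 - q.2) ∧ val d p = val d q ∧
      (thetaBar q d ≤ (Nat.gcd (q.1 - p.1) (q.2 - p.2) : ℤ) ∨
        thetaBar q d ∣ (Nat.gcd p.1 p.2 : ℤ)) := by
  obtain ⟨n, hRn⟩ := hR
  obtain ⟨m, hm, hq1, hq2, hsupp⟩ := exists_edge_coordinates hd hρ hRn hp hq hpq
  have hpn := val_eq_of_mem_supp hRn hp.1
  have hqn := val_eq_of_mem_supp hRn hq.1
  rw [hpn] at hval
  have hσ : d.2 < 0 := by linarith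
  have hm' : (0 : ℤ) < m := by exact_mod_cast hm
  have hlt1 : p.1 < q.1 := by zify; nlinarith
  have hlt2 : p.2 < q.2 := by zify; nlinarith
  refine ⟨⟨hlt1, hlt2, by nlinarith⟩, hpn.trans hqn.symm, ?_⟩
  have hgcd : Nat.gcd (q.1 - p.1) (q.2 - p.2) = m := by
    have e1 : q.1 - p.1 = m * (-d.2).toNat := by
      zify [hlt1.le]; rw [Int.toNat_of_nonneg (by linarith)]; linarith
    have e2 : q.2 - p.2 = m * d.1.toNat := by
      zify [hlt2.le]; rw [Int.toNat_of_nonneg (by linarith)]; linarith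
    have e3 : Nat.gcd (-d.2).toNat d.1.toNat = 1 := by
      have := Int.isCoprime_iff_gcd_eq_one.1 hd
      rw [Int.gcd_eq_natAbs] at this
      rw [Nat.gcd_comm, ← this]
      congr 1 <;> omega
    rw [e1, e2, Nat.gcd_mul_left, e3, mul_one]
  have hRne : R ≠ 0 := by rintro rfl; simpa [supp] using hp.1
  obtain ⟨N, G, w, hGw, hbr⟩ : ∃ (N : ℕ) (G : MvPolynomial (Fin 2) K) (w : ℤ),
      IsWeightedHomogeneous ![d.1, d.2] G w ∧ bracket R G = R ^ (N + 1) := by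
    obtain ⟨G, ⟨w, hGw⟩, i, hi⟩ := hG
    exact ⟨i, R * G, n + w, hRn.mul hGw, by rw [bracket_mul_self, hi, pow_succ']⟩
  have hw : w = N * n - -(d.1 + d.2) := by
    have := weight_of_bracket_eq hRn hGw hRne hbr
    push_cast at this
    linarith
  have hode := ode_of_bracket_eq hRn hGw hbr
  set F := AlgebraicClosure K
  set f : K →+* F := algebraMap K F
  set P : Polynomial F := (dehomogenize R).map f with hPdef
  set Q : Polynomial F := (dehomogenize G).map f with hQdef
  have hcoeffP : ∀ z ∈ supp R, P.coeff z.1 ≠ 0 := fun z hz => by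
    rw [hPdef, Polynomial.coeff_map]
    exact (map_ne_zero f).2 (coeff_dehomogenize hσ.ne hRn hz)
  have hexP : ∀ i, P.coeff i ≠ 0 → ∃ k : ℕ, k ≤ m ∧ (i : ℤ) = p.1 + -d.2 * k := fun i hi => by
    rw [hPdef, Polynomial.coeff_map] at hi
    obtain ⟨j, hj⟩ := exists_mem_supp_of_coeff_dehomogenize_ne_zero ((map_ne_zero f).1 hi)
    obtain ⟨k, hk, h1, -⟩ := hsupp _ hj
    exact ⟨k, hk, h1⟩
  have hodeF : ((N * n - -(d.1 + d.2) : ℤ) : Polynomial F) * Polynomial.derivative P * Q -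
      (n : Polynomial F) * P * Polynomial.derivative Q = (d.2 : Polynomial F) * P ^ (N + 1) := by
    have := congrArg (Polynomial.map f) hode
    rw [hw] at this
    simpa only [Polynomial.map_sub, Polynomial.map_mul, Polynomial.map_intCast,
      Polynomial.map_pow, ← Polynomial.derivative_map] using this
  have hP0 : P ≠ 0 := fun h => hcoeffP p hp.1 (by rw [h]; simp)
  have hPr : P.rootMultiplicity 0 = p.1 := by
    refine rootMultiplicity_zero_eq (hcoeffP p hp.1) fun i hi => ?_
    obtain ⟨k, -, h1⟩ := hexP i hi
    zify
    nlinarith [mul_nonneg (neg_nonneg.2 hσ.le) (Int.natCast_nonneg k)]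
  have hroot0 : P.IsRoot 0 := (Polynomial.rootMultiplicity_pos hP0).1 (hPr ▸ hp1)
  obtain ⟨β, hβ, hβP⟩ := exists_ne_zero_isRoot (hcoeffP q hq.1) (hPr ▸ hlt1)
  have htheta : ∀ μ : ℤ, n ∣ (d.1 + d.2) * μ → thetaBar q d ∣ μ := fun μ h => by
    rw [thetaBar, hqn]
    exact ediv_gcd_dvd_of_dvd_mul hval.ne' h
  rcases exists_resonant_root_of_ode hP0 hσ.ne hval (by linarith) hodeF hroot0 hβ hβP with
    ⟨α, hα, hαP, hdvd⟩ | hres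
  · left
    rw [neg_mul, dvd_neg] at hdvd
    have hμ := (Polynomial.rootMultiplicity_pos hP0).2 hαP
    have hle : P.rootMultiplicity α ≤ m := by
      have h1 := rootMultiplicity_lt_card_support hα _ P hP0 rfl
      have h2 : P.support ⊆ (Finset.range (m + 1)).image
          fun k : ℕ => ((p.1 : ℤ) + -d.2 * k).toNat := by
        intro i hi
        obtain ⟨k, hk, h3⟩ := hexP i (Polynomial.mem_support_iff.1 hi)
        exact Finset.mem_image.2 ⟨k, Finset.mem_range.2 (by omega), by omega⟩
      have h3 := (Finset.card_le_card h2).trans Finset.card_image_le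
      rw [Finset.card_range] at h3
      omega
    rw [hgcd]
    refine (Int.le_of_dvd (by exact_mod_cast hμ) (htheta _ hdvd)).trans ?_
    exact_mod_cast hle
  · right
    have hQ0 : Q ≠ 0 := by
      intro h
      rw [h] at hodeF
      have : (d.2 : Polynomial F) * P ^ (N + 1) ≠ 0 :=
        mul_ne_zero (Int.cast_ne_zero.2 hσ.ne) (pow_ne_zero _ hP0)
      exact this (by rw [← hodeF]; simp)
    -- The lowest term of `Q` comes from a point of the support of `G`; its ordinate `v` carries the
    -- resonance over to the second coordinate.
    obtain ⟨v, hv⟩ : ∃ v, (Q.rootMultiplicity 0, v) ∈ supp G := by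
      refine exists_mem_supp_of_coeff_dehomogenize_ne_zero fun h => ?_
      refine (Polynomial.trailingCoeff_nonzero_iff_nonzero (p := Q)).2 hQ0 ?_
      rw [Polynomial.trailingCoeff, ← Polynomial.rootMultiplicity_eq_natTrailingDegree', hQdef,
        Polynomial.coeff_map, ← hQdef, h, map_zero]
    have hv' := val_eq_of_mem_supp hGw hv
    rw [hPr] at hres
    simp only [val, hw] at hv' hpn
    -- The points `n (ν, v)` and `w p` have equal valuation `n w` and equal abscissa, hence equal
    -- ordinate since `σ ≠ 0`.
    have hs : n * v = (N * n - -(d.1 + d.2)) * p.2 := by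
      refine mul_left_cancel₀ hσ.ne ?_
      linear_combination n * hv' - d.1 * hres - (N * n - -(d.1 + d.2)) * hpn
    have h1 : thetaBar q d ∣ (p.1 : ℤ) :=
      htheta _ ⟨Q.rootMultiplicity 0 - N * p.1, by linear_combination -hres⟩
    have h2 : thetaBar q d ∣ (p.2 : ℤ) := htheta _ ⟨v - N * p.2, by linear_combination -hs⟩
    have := Int.dvd_coe_gcd h1 h2
    simpa using this

end Edge

/-! ### Corners of an admissible chain -/

namespace AdmissibleChain

variable {K : Type*} [Field K] {k : ℕ}

/-- The chain without its last edge. -/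
def init (c : AdmissibleChain K (k + 1)) : AdmissibleChain K k where
  C j := c.C j.castSucc
  R j := c.R j.castSucc
  dir j := c.dir j.castSucc
  first_pos := c.first_pos
  first_axis := c.first_axis
  dir_isDirection j := c.dir_isDirection _
  dir_lower j := c.dir_lower _
  dir_upper j := c.dir_upper _
  dir_strictMono i j h := c.dir_strictMono _ _ (by simpa using h)
  homogeneous j := c.homogeneous _
  start_eq j := c.start_eq _
  end_eq j := c.end_eq _
  corner_ne j := c.corner_ne _
  exists_bracket_eq j := c.exists_bracket_eq _

lemma dir_fst_pos (c : AdmissibleChain K k) (j : Fin k) : 0 < (c.dir j).1 := by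
  simpa [DirLT] using c.dir_lower j

lemma val_castSucc_eq (c : AdmissibleChain K k) (j : Fin k) :
    val (c.dir j) (c.C j.castSucc) = val (c.dir j) (c.C j.succ) := by
  obtain ⟨n, hn⟩ := c.homogeneous j
  rw [val_eq_of_mem_supp hn (c.start_eq j).1, val_eq_of_mem_supp hn (c.end_eq j).1]

/-- The last corner has valuation at least `e.1` for every direction `e` after those of the
chain. -/
lemma fst_le_val_last {k : ℕ} (c : AdmissibleChain K k) (e : ℤ × ℤ) (he : 0 < e.1)
    (h : ∀ j, 0 ≤ (c.dir j).1 * e.2 - (c.dir j).2 * e.1) :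
    e.1 ≤ val e (c.C (Fin.last k)) := by
  induction k generalizing e with
  | zero =>
    have h1 := c.first_pos
    have h2 := c.first_axis
    change e.1 ≤ val e (c.C 0)
    simp only [val, h2]
    push_cast
    nlinarith
  | succ k ih =>
    set d := c.dir (Fin.last k)
    set p := c.C (Fin.last (k + 1))
    have hd : 0 < d.1 := c.dir_fst_pos _
    have h1 : d.1 ≤ val d p := by
      have h2 := ih c.init d hd fun j => (c.dir_strictMono _ _ (Fin.castSucc_lt_last j)).le
      exact h2.trans_eq (c.val_castSucc_eq (Fin.last k))
    have h3 := h (Fin.last k)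
    -- Writing `d × e` for the cross product, `d.1 * val e p = e.1 * val d p + (d × e) * p.2`, and
    -- the last term is nonnegative.
    have h4 : e.1 * d.1 ≤ val e p * d.1 := by
      have h5 := mul_le_mul_of_nonneg_left h1 he.le
      have h6 := mul_nonneg h3 (Int.natCast_nonneg p.2)
      change 0 ≤ (d.1 * e.2 - d.2 * e.1) * (p.2 : ℤ) at h6
      simp only [val] at h5 ⊢
      linarith
    exact le_of_mul_le_mul_right h4 hd

lemma isPossibleFinalPair_last (c : AdmissibleChain K k) :
    ∃ d, IsPossibleFinalPair K (c.C (Fin.last k)) d := by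
  rcases k with _ | k
  · exact ⟨(0, -1), c.first_pos, ⟨isCoprime_zero_left.2 (by simp), Or.inl rfl, by simp [DirLT]⟩,
      Or.inl ⟨c.first_axis, rfl⟩⟩
  · refine ⟨c.dir (Fin.last k), ?_, ⟨c.dir_isDirection _, Or.inr (c.dir_lower _), c.dir_upper _⟩,
      Or.inr ⟨k, c, rfl, rfl⟩⟩
    -- For `e = (1, -1)` the bound says that abscissa minus ordinate is at least `1`, so the
    -- abscissa is positive.
    have h := c.fst_le_val_last (1, -1) one_pos fun j => (c.dir_upper j).le
    simp only [val] at h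
    omega

end AdmissibleChain

end LowerCorner

theorem mainTheorem6 (K : Type*) [Field K] [CharZero K] (a b : ℕ) (ρ σ : ℤ)
    (hfinal : LowerCorner.IsPossibleFinalPair K (a, b) (ρ, σ)) (hb : 0 < b) (hab : a ≤ 2 * b) :
    ρ ≤ LowerCorner.val (ρ, σ) (a, b) ∧
      ∃ (r s : ℕ) (ρ' σ' : ℤ), LowerCorner.IsPossibleFinalPair K (r, s) (ρ', σ') ∧
        (r < a ∧ s < b ∧ (r : ℤ) - s < (a : ℤ) - b) ∧
        LowerCorner.val (ρ, σ) (r, s) = LowerCorner.val (ρ, σ) (a, b) ∧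
        (LowerCorner.thetaBar (a, b) (ρ, σ) ≤ (Nat.gcd (a - r) (b - s) : ℤ) ∨
          LowerCorner.thetaBar (a, b) (ρ, σ) ∣ (Nat.gcd r s : ℤ)) := by
  obtain ⟨-, -, ⟨hb0, -⟩ | ⟨n, c, hC, hdir⟩⟩ := hfinal
  · exact absurd hb0 hb.ne'
  have hρ : 0 < ρ := by simpa [hdir] using c.dir_fst_pos (Fin.last n)
  have hup := c.dir_upper (Fin.last n)
  have hmono : ∀ j, 0 ≤ (c.dir j).1 * σ - (c.dir j).2 * ρ := by
    intro j
    rcases (Fin.le_last j).eq_or_lt with rfl | h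
    · rw [hdir]; simp [mul_comm]
    · have := c.dir_strictMono _ _ h
      rw [hdir] at this
      exact this.le
  have h1 := c.fst_le_val_last (ρ, σ) hρ hmono
  rw [hC] at h1
  -- If the chain has a single edge, the truncated chain is just the point `(c, 0)`, paired with
  -- `(0, -1)`.
  obtain ⟨⟨ρ', σ'⟩, hpair⟩ := c.init.isPossibleFinalPair_last
  have hval := c.val_castSucc_eq (Fin.last n)
  have hend := c.end_eq (Fin.last n)
  have hne := c.corner_ne (Fin.last n)
  rw [Fin.succ_last, hC] at hval hend hne
  have hdirn := c.dir_isDirection (Fin.last n)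
  have hhom := c.homogeneous (Fin.last n)
  have hstart := c.start_eq (Fin.last n)
  have hbr := c.exists_bracket_eq (Fin.last n)
  rw [hdir] at hval hend hstart hhom hdirn hup
  rw [hdir] at hbr
  have hρσ : ρ + σ < 0 := by simp only [LowerCorner.DirLT] at hup; linarith
  obtain ⟨h2, h3, h4⟩ := LowerCorner.thetaBar_le_or_dvd_of_edge hdirn hρ hρσ hhom hstart hend hne
    hpair.1 (by rw [hval]; exact hρ.trans_le h1) hbr
  exact ⟨h1, _, _, ρ', σ', hpair, h2, h3, h4⟩
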